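/- Let $a<b$ be real, $0<\alpha<1$, $x\in[a,b]$, and let $\bar n, m\ge 1$ be integers. *Operators.* Put $\varphi(t)=t\,(1+t^{2m})^{-1/(2m)}$ and $\Phi(t)=\frac14[\varphi(t+1)-\varphi(t-1)]$ for $t\in\mathbb R$. For $n\in\mathbb N$ with $\lceil na\rceil\le\lfloor nb\rfloor$ put $$A_nf(x)=\frac{\sum_{k=\lceil na\rceil}^{\lfloor nb\rfloor} f(k/n)\,\Phi(nx-k)}{\sum_{k=\lceil na\rceil}^{\lfloor nb\rfloor}\Phi(nx-k)}.$$ *Caputo derivatives.* For an absolutely continuous $g$ on $[x,b]$, resp. on $[a,x]$, let $$D_{*x}^{\alpha}g(y)=\frac1{\Gamma(1-\alpha)}\int_x^y (y-t)^{-\alpha}g'(t)\,dt\quad(x\le y\le b),$$ $$D_{x-}^{\alpha}g(y)=\frac{-1}{\Gamma(1-\alpha)}\int_y^x (t-y)^{-\alpha}g'(t)\,dt\quad(a\le y\le x),$$ and let $D_{*x}^{k\alpha}$, $D_{x-}^{k\alpha}$ be the $k$-fold iterates of these operators ($k=0$: the identity). For $\delta>0$ and $g$ continuous on an interval $I$ let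 $\omega_1(g,\delta)_I=\sup\{|g(y)-g(z)|: y,z\in I,\ |y-z|\le\delta\}$, and let $$\omega_1\big(D_x^{(\bar n+1)\alpha}f,\delta\big)=\max\Big\{\omega_1\big(D_{*x}^{(\bar n+1)\alpha}f,\delta\big)_{[x,b]},\ \omega_1\big(D_{x-}^{(\bar n+1)\alpha}f,\delta\big)_{[a,x]}\Big\}.$$ *Hypotheses.* Let $f:[a,b]\to\mathbb R$ be absolutely continuous with $f'\in L_\infty([a,b])$. Assume that $D_{*x}^{k\alpha}f$ is absolutely continuous on $[x,b]$ and $D_{x-}^{k\alpha}f$ is absolutely continuous on $[a,x]$ for $k=1,\dots,\bar n$ (so that the iterated derivatives are defined), that $D_{*x}^{k\alpha}f\in C([x,b])$ and $D_{x-}^{k\alpha}f\in C([a,x])$ for $k=0,1,\dots,\bar n+1$, and that $D_{*x}^{i\alpha}f(x)=0=D_{x-}^{i\alpha}f(x)$ for $i=2,\dots,\bar n+1$. *Conclusion.* For every $n\in\mathbb N$ with $n^{1-\alpha}>2$ and $\lceil na\rceil\le\lfloor nb\rfloor$ and every $\delta>0$, $$|A_nf(x)-f(x)|\le\frac{2\,(1+4^m)^{1/(2m)}\;\omega_1\big(D_x^{(\bar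 n+1)\alpha}f,\delta\big)}{\Gamma((\bar n+1)\alpha+1)}\Bigg\{\frac1{n^{(\bar n+1)\alpha^2}}+\frac{(b-a)^{(\bar n+1)\alpha}}{4m\,(n^{1-\alpha}-2)^{2m}}$$ $$\qquad+\frac1{\delta((\bar n+1)\alpha+1)}\bigg[\frac1{n^{\alpha[(\bar n+1)\alpha+1]}}+\frac{(b-a)^{(\bar n+1)\alpha+1}}{4m\,(n^{1-\alpha}-2)^{2m}}\bigg]\Bigg\}.$$ Consequently $\lim_{n\to\infty}A_nf(x)=f(x)$. -/

import Mathlib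

noncomputable section

/-- The generator function `φ(x) = x / (1 + x ^ (2m)) ^ (1 / (2m))`. -/
def sigmoidGen (m : ℕ) (x : ℝ) : ℝ :=
  x / (1 + x ^ (2 * m)) ^ (1 / (2 * (m : ℝ)))

/-- The activation function `Φ(x) = (φ(x + 1) - φ(x - 1)) / 4`. -/
def activation (m : ℕ) (x : ℝ) : ℝ :=
  (1 / 4) * (sigmoidGen m (x + 1) - sigmoidGen m (x - 1))

/-- The normalized neural network operator `A_n(f, x)` on `[a, b]`. It is meant for those `n` with
`⌈n a⌉ ≤ ⌊n b⌋`, i.e. such that some `k / n` lies in `[a, b]`. -/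
def neuralOp (m : ℕ) (a b : ℝ) (n : ℕ) (f : ℝ → ℝ) (x : ℝ) : ℝ :=
  (∑ k ∈ Finset.Icc ⌈(n : ℝ) * a⌉ ⌊(n : ℝ) * b⌋,
      f ((k : ℝ) / (n : ℝ)) * activation m ((n : ℝ) * x - (k : ℝ))) /
    ∑ k ∈ Finset.Icc ⌈(n : ℝ) * a⌉ ⌊(n : ℝ) * b⌋, activation m ((n : ℝ) * x - (k : ℝ))

/-- The first modulus of continuity `ω₁(g, δ)` over the set `s`. -/
def modulusOn (s : Set ℝ) (g : ℝ → ℝ) (δ : ℝ) : ℝ :=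
  sSup {r : ℝ | ∃ y ∈ s, ∃ z ∈ s, |y - z| ≤ δ ∧ r = |g y - g z|}

/-- The left Caputo derivative of order `0 < α < 1` with anchor `x`, set to `0` left of `x`.
The integrand only involves the derivative of `g` at points between `x` and `y`. -/
def caputoLeft (α x : ℝ) (g : ℝ → ℝ) (y : ℝ) : ℝ :=
  if x ≤ y then (1 / Real.Gamma (1 - α)) * ∫ t in x..y, (y - t) ^ (-α) * deriv g t else 0

/-- The right Caputo derivative of order `0 < α < 1` with anchor `x`, set to `0` right of `x`. -/
def caputoRight (α x : ℝ) (g : ℝ → ℝ) (y : ℝ) : ℝ :=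
  if y ≤ x then (-1 / Real.Gamma (1 - α)) * ∫ t in y..x, (t - y) ^ (-α) * deriv g t else 0

/-- The `k`-fold iterate `D_{*x}^{kα} f` of the left Caputo derivative of order `α`. -/
def iterCaputoLeft (α x : ℝ) (k : ℕ) (f : ℝ → ℝ) : ℝ → ℝ :=
  (caputoLeft α x)^[k] f

/-- The `k`-fold iterate `D_{x-}^{kα} f` of the right Caputo derivative of order `α`. -/
def iterCaputoRight (α x : ℝ) (k : ℕ) (f : ℝ → ℝ) : ℝ → ℝ :=
  (caputoRight α x)^[k] f

/-- `ω₁(D_x^{kα} f, δ)`: the larger of the moduli of `D_{*x}^{kα} f` over `[x, b]` and of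
`D_{x-}^{kα} f` over `[a, x]`. -/
def caputoModulus (α a b x : ℝ) (k : ℕ) (f : ℝ → ℝ) (δ : ℝ) : ℝ :=
  max (modulusOn (Set.Icc x b) (iterCaputoLeft α x k f) δ)
    (modulusOn (Set.Icc a x) (iterCaputoRight α x k f) δ)

end

/-!
Every Caputo derivative vanishes at its anchor, since it is an integral over an interval that has
shrunk to a point. The fractional kernels satisfy `k_μ * k_ν = k_(μ+ν)` under convolution, by
Euler's Beta integral, so undoing the derivatives one at a time gives a Taylor formula with no
polynomial part beyond `f x`: right of `x`, `f - f x` is the fractional integral of order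
`(N + 1) α` of `D_{*x}^{(N+1)α} f`. That function vanishes at `x`, hence is at most
`ω (1 + (t - x) / δ)` at `t`, and integrating this against the kernel bounds `|f y - f x|`. The
reflection `t ↦ -t` carries the estimate over to the left of `x`.

The operator averages the values `f (k / n)` with weights `Φ (n x - k)`. Nodes within `n ^ (-α)` of
`x` contribute the local error. The weights at the other nodes form tails of a telescoping series,
and these are small because `φ` tends to `1` at the rate of Bernoulli's inequality.
-/

open MeasureTheory ProbabilityTheory Set Filter Topology

/-! ### The Riemann–Liouville kernels -/

/-- The kernel `u₊ ^ (μ - 1) / Γ(μ)` of fractional integration of order `μ`. Cutting it off at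
`u ≤ 0` turns integrals over `(x, y)` into integrals over `(x, ∞)`, whose domain no longer depends
on the upper limit. -/
noncomputable def rlKernel (μ : ℝ) : ℝ → ℝ :=
  (Ioi 0).indicator fun u => u ^ (μ - 1) / Real.Gamma μ

lemma rlKernel_of_pos (μ : ℝ) {u : ℝ} (hu : 0 < u) : rlKernel μ u = u ^ (μ - 1) / Real.Gamma μ :=
  indicator_of_mem (mem_Ioi.2 hu) _

lemma rlKernel_of_nonpos (μ : ℝ) {u : ℝ} (hu : u ≤ 0) : rlKernel μ u = 0 :=
  indicator_of_notMem (notMem_Ioi.2 hu) _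

lemma rlKernel_nonneg {μ : ℝ} (hμ : 0 < μ) (u : ℝ) : 0 ≤ rlKernel μ u :=
  indicator_nonneg (fun _ hu => div_nonneg (Real.rpow_nonneg (mem_Ioi.1 hu).le _)
    (Real.Gamma_pos_of_pos hμ).le) u

lemma rlKernel_add_one {μ u : ℝ} (hμ : 0 < μ) (hu : 0 ≤ u) :
    rlKernel (μ + 1) u = u ^ μ / Real.Gamma (μ + 1) := by
  rcases hu.eq_or_lt with rfl | hu
  · rw [rlKernel_of_nonpos _ le_rfl, Real.zero_rpow hμ.ne', zero_div]
  · rw [rlKernel_of_pos _ hu, add_sub_cancel_right]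

@[fun_prop]
lemma measurable_rlKernel (μ : ℝ) : Measurable (rlKernel μ) :=
  Measurable.indicator (by fun_prop) measurableSet_Ioi

lemma betaPDFReal_nonneg {μ ν : ℝ} (hμ : 0 < μ) (hν : 0 < ν) (u : ℝ) : 0 ≤ betaPDFReal μ ν u := by
  by_cases h : 0 < u ∧ u < 1
  · exact (betaPDFReal_pos h.1 h.2 hμ hν).le
  · rw [betaPDFReal, if_neg h]

lemma integrable_betaPDFReal {μ ν : ℝ} (hμ : 0 < μ) (hν : 0 < ν) :
    Integrable (betaPDFReal μ ν) := by
  rw [← lintegral_ofReal_ne_top_iff_integrable (by fun_prop)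
    (ae_of_all _ (betaPDFReal_nonneg hμ hν))]
  exact (lintegral_betaPDF_eq_one hμ hν).trans_ne ENNReal.one_ne_top

lemma integral_betaPDFReal {μ ν : ℝ} (hμ : 0 < μ) (hν : 0 < ν) : ∫ u, betaPDFReal μ ν u = 1 := by
  rw [integral_eq_lintegral_of_nonneg_ae (ae_of_all _ (betaPDFReal_nonneg hμ hν)) (by fun_prop)]
  exact (congrArg ENNReal.toReal (lintegral_betaPDF_eq_one hμ hν)).trans ENNReal.toReal_one

-- Up to the factor `rlKernel (μ + ν) (y - t)`, this is the beta density rescaled to `(t, y)`.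
lemma rlKernel_mul_rlKernel {μ ν t y : ℝ} (hμ : 0 < μ) (hν : 0 < ν) (h : t < y) (s : ℝ) :
    rlKernel μ (y - s) * rlKernel ν (s - t) =
      rlKernel (μ + ν) (y - t) / (y - t) * betaPDFReal ν μ ((s - t) / (y - t)) := by
  have hL : 0 < y - t := sub_pos.2 h
  rcases le_or_gt s t with hst | hst
  · have hu : ¬0 < (s - t) / (y - t) := (div_nonpos_of_nonpos_of_nonneg (by linarith) hL.le).not_gt
    rw [rlKernel_of_nonpos ν (sub_nonpos.2 hst), betaPDFReal, if_neg (hu ·.1), mul_zero, mul_zero]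
  rcases le_or_gt y s with hys | hys
  · have hu : ¬(s - t) / (y - t) < 1 := by rw [div_lt_one hL]; linarith
    rw [rlKernel_of_nonpos μ (sub_nonpos.2 hys), betaPDFReal, if_neg (hu ·.2), zero_mul, mul_zero]
  · have hs : 0 < s - t := sub_pos.2 hst
    have hs' : 0 < y - s := sub_pos.2 hys
    have hu : (s - t) / (y - t) < 1 := by rw [div_lt_one hL]; linarith
    have hu' : 1 - (s - t) / (y - t) = (y - s) / (y - t) := by field_simp; ring
    have hpow : (y - t) ^ (μ + ν - 1) = (y - t) ^ (ν - 1) * (y - t) ^ (μ - 1) * (y - t) := by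
      rw [← Real.rpow_add hL, ← Real.rpow_add_one hL.ne']; congr 1; ring
    have hΓ := (Real.Gamma_pos_of_pos (add_pos hμ hν)).ne'
    rw [rlKernel_of_pos _ hs, rlKernel_of_pos _ hs', rlKernel_of_pos _ hL, betaPDFReal,
      if_pos ⟨div_pos hs hL, hu⟩, hu', Real.div_rpow hs.le hL.le, Real.div_rpow hs'.le hL.le, hpow,
      beta, add_comm ν μ]
    have := (Real.rpow_pos_of_pos hL (ν - 1)).ne'
    have := (Real.rpow_pos_of_pos hL (μ - 1)).ne'
    field_simp

lemma rlKernel_mul_rlKernel_of_le (μ ν : ℝ) {t y : ℝ} (h : y ≤ t) (s : ℝ) :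
    rlKernel μ (y - s) * rlKernel ν (s - t) = 0 := by
  rcases le_or_gt y s with hs | hs
  · rw [rlKernel_of_nonpos μ (sub_nonpos.2 hs), zero_mul]
  · rw [rlKernel_of_nonpos ν (by linarith), mul_zero]

lemma integrable_rlKernel_mul_rlKernel {μ ν : ℝ} (hμ : 0 < μ) (hν : 0 < ν) (t y : ℝ) :
    Integrable fun s => rlKernel μ (y - s) * rlKernel ν (s - t) := by
  rcases lt_or_ge t y with h | h
  · simp_rw [rlKernel_mul_rlKernel hμ hν h]
    exact (((integrable_betaPDFReal hν hμ).comp_div (sub_pos.2 h).ne').comp_sub_right t).const_mul _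
  · simp_rw [rlKernel_mul_rlKernel_of_le μ ν h]
    exact integrable_zero _ _ _

lemma integral_rlKernel_mul_rlKernel {μ ν : ℝ} (hμ : 0 < μ) (hν : 0 < ν) (t y : ℝ) :
    ∫ s, rlKernel μ (y - s) * rlKernel ν (s - t) = rlKernel (μ + ν) (y - t) := by
  rcases lt_or_ge t y with h | h
  · simp_rw [rlKernel_mul_rlKernel hμ hν h]
    rw [integral_const_mul, integral_sub_right_eq_self (fun s => betaPDFReal ν μ (s / (y - t))),
      Measure.integral_comp_div, integral_betaPDFReal hν hμ, abs_of_pos (sub_pos.2 h), smul_eq_mul,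
      mul_one, div_mul_cancel₀ _ (sub_pos.2 h).ne']
  · simp_rw [rlKernel_mul_rlKernel_of_le μ ν h, integral_zero,
      rlKernel_of_nonpos _ (sub_nonpos.2 h)]

lemma integrable_prod_rlKernel_mul_rlKernel_mul {μ ν y : ℝ} (hμ : 0 < μ) (hν : 0 < ν)
    {ρ : Measure ℝ} [SFinite ρ] {g : ℝ → ℝ}
    (hg : Integrable (fun t => rlKernel (μ + ν) (y - t) * g t) ρ) :
    Integrable (Function.uncurry fun s t => rlKernel μ (y - s) * rlKernel ν (s - t) * g t)
      (volume.prod ρ) := by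
  have hmeas : AEStronglyMeasurable
      (Function.uncurry fun s t => rlKernel μ (y - s) * rlKernel ν (s - t) * g t)
      (volume.prod ρ) := by
    -- `g` itself is measurable only where `t < y`, which is all the product sees.
    have hfactor : (Function.uncurry fun s t => rlKernel μ (y - s) * rlKernel ν (s - t) * g t) =
        fun p : ℝ × ℝ => rlKernel μ (y - p.1) * rlKernel ν (p.1 - p.2) *
          ((rlKernel (μ + ν) (y - p.2))⁻¹ * (rlKernel (μ + ν) (y - p.2) * g p.2)) := by
      ext ⟨s, t⟩
      rcases lt_or_ge t y with h | h
      · have hK : rlKernel (μ + ν) (y - t) ≠ 0 := by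
          rw [rlKernel_of_pos _ (sub_pos.2 h)]
          exact (div_pos (Real.rpow_pos_of_pos (sub_pos.2 h) _)
            (Real.Gamma_pos_of_pos (add_pos hμ hν))).ne'
        simp only [Function.uncurry_apply_pair, inv_mul_cancel_left₀ hK]
      · simp only [Function.uncurry_apply_pair, rlKernel_mul_rlKernel_of_le μ ν h, zero_mul]
    rw [hfactor]
    have hK : Measurable fun p : ℝ × ℝ => rlKernel μ (y - p.1) * rlKernel ν (p.1 - p.2) := by
      fun_prop
    have hK' : Measurable fun p : ℝ × ℝ => (rlKernel (μ + ν) (y - p.2))⁻¹ := by fun_prop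
    exact hK.aestronglyMeasurable.mul
      (hK'.aestronglyMeasurable.mul hg.aestronglyMeasurable.comp_snd)
  refine (integrable_prod_iff' hmeas).2 ⟨ae_of_all _ fun t =>
    (integrable_rlKernel_mul_rlKernel hμ hν t y).mul_const (g t), hg.norm.congr <| ae_of_all _ ?_⟩
  intro t
  simp only [Function.uncurry_apply_pair, norm_mul, Real.norm_of_nonneg (rlKernel_nonneg hμ _),
    Real.norm_of_nonneg (rlKernel_nonneg hν _),
    Real.norm_of_nonneg (rlKernel_nonneg (add_pos hμ hν) _)]
  rw [integral_mul_const, integral_rlKernel_mul_rlKernel hμ hν]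

lemma integral_rlKernel_mul_integral {μ ν y : ℝ} (hμ : 0 < μ) (hν : 0 < ν)
    {ρ : Measure ℝ} [SFinite ρ] {g : ℝ → ℝ}
    (hg : Integrable (fun t => rlKernel (μ + ν) (y - t) * g t) ρ) :
    ∫ s, rlKernel μ (y - s) * ∫ t, rlKernel ν (s - t) * g t ∂ρ =
      ∫ t, rlKernel (μ + ν) (y - t) * g t ∂ρ :=
  calc ∫ s, rlKernel μ (y - s) * ∫ t, rlKernel ν (s - t) * g t ∂ρ
      = ∫ s, ∫ t, rlKernel μ (y - s) * rlKernel ν (s - t) * g t ∂ρ := by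
        simp_rw [mul_assoc, integral_const_mul]
    _ = ∫ t, (∫ s, rlKernel μ (y - s) * rlKernel ν (s - t) * g t) ∂ρ :=
        integral_integral_swap (integrable_prod_rlKernel_mul_rlKernel_mul hμ hν hg)
    _ = ∫ t, rlKernel (μ + ν) (y - t) * g t ∂ρ := by
        simp_rw [integral_mul_const, integral_rlKernel_mul_rlKernel hμ hν]

/-! ### Fractional integrals and Caputo derivatives -/

/-- The left Riemann–Liouville fractional integral
`y ↦ Γ(μ)⁻¹ ∫ t in x..y, (y - t) ^ (μ - 1) * g t` of order `μ` with anchor `x`, set to `0` left of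
`x`. -/
noncomputable def rlIntegral (μ x : ℝ) (g : ℝ → ℝ) (y : ℝ) : ℝ :=
  ∫ t in Ioi x, rlKernel μ (y - t) * g t

lemma rlKernel_sub_mul_eq_indicator (μ y : ℝ) (g : ℝ → ℝ) :
    (fun t => rlKernel μ (y - t) * g t) =
      (Iio y).indicator fun t => (y - t) ^ (μ - 1) / Real.Gamma μ * g t := by
  ext t
  rcases lt_or_ge t y with h | h
  · rw [indicator_of_mem (mem_Iio.2 h), rlKernel_of_pos μ (sub_pos.2 h)]
  · rw [indicator_of_notMem (notMem_Iio.2 h), rlKernel_of_nonpos μ (sub_nonpos.2 h), zero_mul]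

lemma rlIntegral_eq_setIntegral (μ x y : ℝ) (g : ℝ → ℝ) :
    rlIntegral μ x g y = ∫ t in Ioo x y, (y - t) ^ (μ - 1) / Real.Gamma μ * g t := by
  rw [rlIntegral, rlKernel_sub_mul_eq_indicator, setIntegral_indicator measurableSet_Iio,
    Ioi_inter_Iio]

lemma integrableOn_rlKernel_mul_iff (μ : ℝ) {x y : ℝ} (hxy : x ≤ y) (g : ℝ → ℝ) :
    IntegrableOn (fun t => rlKernel μ (y - t) * g t) (Ioi x) ↔
      IntervalIntegrable (fun t => (y - t) ^ (μ - 1) / Real.Gamma μ * g t) volume x y := by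
  rw [rlKernel_sub_mul_eq_indicator, integrableOn_indicator_iff measurableSet_Iio, inter_comm,
    Ioi_inter_Iio, intervalIntegrable_iff_integrableOn_Ioo_of_le hxy]

lemma rlIntegral_of_le (μ : ℝ) {x y : ℝ} (hxy : x ≤ y) (g : ℝ → ℝ) :
    rlIntegral μ x g y = ∫ t in x..y, (y - t) ^ (μ - 1) / Real.Gamma μ * g t := by
  rw [rlIntegral_eq_setIntegral, intervalIntegral.integral_of_le hxy, integral_Ioc_eq_integral_Ioo]

lemma rlIntegral_of_ge (μ : ℝ) {x y : ℝ} (hyx : y ≤ x) (g : ℝ → ℝ) : rlIntegral μ x g y = 0 := by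
  rw [rlIntegral_eq_setIntegral, Ioo_eq_empty hyx.not_gt, setIntegral_empty]

lemma rlIntegral_congr {μ x y : ℝ} {g h : ℝ → ℝ} (hgh : EqOn g h (Ioo x y)) :
    rlIntegral μ x g y = rlIntegral μ x h y := by
  simp_rw [rlIntegral_eq_setIntegral]
  exact setIntegral_congr_fun measurableSet_Ioo fun t ht => by simp only [hgh ht]

theorem rlIntegral_rlIntegral {μ ν x y : ℝ} (hμ : 0 < μ) (hν : 0 < ν) {g : ℝ → ℝ}
    (hg : IntegrableOn (fun t => rlKernel (μ + ν) (y - t) * g t) (Ioi x)) :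
    rlIntegral μ x (rlIntegral ν x g) y = rlIntegral (μ + ν) x g y := by
  have hzero : ∀ s ∉ Ioi x, rlKernel μ (y - s) * rlIntegral ν x g s = 0 := fun s hs => by
    rw [rlIntegral_of_ge ν (notMem_Ioi.1 hs), mul_zero]
  rw [rlIntegral, setIntegral_eq_integral_of_forall_compl_eq_zero hzero]
  exact integral_rlKernel_mul_integral hμ hν hg

lemma caputoLeft_eq_rlIntegral (α x : ℝ) (g : ℝ → ℝ) :
    caputoLeft α x g = rlIntegral (1 - α) x (deriv g) := by
  ext y
  rcases le_or_gt x y with h | h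
  · rw [caputoLeft, if_pos h, rlIntegral_of_le _ h, ← intervalIntegral.integral_const_mul]
    congr 1 with t
    rw [sub_sub_cancel_left]
    ring
  · rw [caputoLeft, if_neg h.not_ge, rlIntegral_of_ge _ h.le]

lemma caputoLeft_self (α x : ℝ) (g : ℝ → ℝ) : caputoLeft α x g x = 0 := by
  rw [caputoLeft_eq_rlIntegral, rlIntegral_of_ge _ le_rfl]

lemma iterCaputoLeft_succ (α x : ℝ) (k : ℕ) (f : ℝ → ℝ) :
    iterCaputoLeft α x (k + 1) f = caputoLeft α x (iterCaputoLeft α x k f) :=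
  Function.iterate_succ_apply' _ _ _

lemma iterCaputoRight_succ (α x : ℝ) (k : ℕ) (f : ℝ → ℝ) :
    iterCaputoRight α x (k + 1) f = caputoRight α x (iterCaputoRight α x k f) :=
  Function.iterate_succ_apply' _ _ _

theorem rlIntegral_caputoLeft {α x y : ℝ} (hα0 : 0 < α) (hα1 : α < 1) (hxy : x ≤ y) {g : ℝ → ℝ}
    (hg : AbsolutelyContinuousOnInterval g x y) :
    rlIntegral α x (caputoLeft α x g) y = g y - g x := by
  have hint : IntegrableOn (fun t => rlKernel (α + (1 - α)) (y - t) * deriv g t) (Ioi x) := by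
    rw [integrableOn_rlKernel_mul_iff _ hxy]
    simpa using hg.intervalIntegrable_deriv
  rw [caputoLeft_eq_rlIntegral, rlIntegral_rlIntegral hα0 (sub_pos.2 hα1) hint,
    rlIntegral_of_le _ hxy, ← hg.integral_deriv_eq_sub]
  simp

lemma integrableOn_rlKernel_mul_of_continuousOn {μ x y : ℝ} (hμ : 0 < μ) (hxy : x ≤ y)
    {g : ℝ → ℝ} (hg : ContinuousOn g (Icc x y)) :
    IntegrableOn (fun t => rlKernel μ (y - t) * g t) (Ioi x) := by
  rw [integrableOn_rlKernel_mul_iff μ hxy]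
  have hpow := (intervalIntegral.intervalIntegrable_rpow' (show -1 < μ - 1 by linarith)
    (a := y - x) (b := 0)).comp_sub_left y
  rw [sub_sub_cancel, sub_zero] at hpow
  exact (hpow.div_const _).mul_continuousOn (by rwa [uIcc_of_le hxy])

/-- Fractional Taylor formula: the polynomial part vanishes because every Caputo derivative does at
its anchor. -/
theorem sub_eq_rlIntegral_iterCaputoLeft {α x b : ℝ} (hα0 : 0 < α) (hα1 : α < 1) {f : ℝ → ℝ} {N : ℕ}
    (hac : ∀ k ≤ N, AbsolutelyContinuousOnInterval (iterCaputoLeft α x k f) x b)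
    (hcont : ContinuousOn (iterCaputoLeft α x (N + 1) f) (Icc x b)) {y : ℝ} (hy : y ∈ Icc x b) :
    f y - f x = rlIntegral ((N + 1) * α) x (iterCaputoLeft α x (N + 1) f) y := by
  have hstep : ∀ k ≤ N, ∀ t ∈ Icc x b, rlIntegral α x (iterCaputoLeft α x (k + 1) f) t =
      iterCaputoLeft α x k f t - iterCaputoLeft α x k f x := fun k hk t ht => by
    rw [iterCaputoLeft_succ]
    refine rlIntegral_caputoLeft hα0 hα1 ht.1 ((hac k hk).mono ?_)
    rw [uIcc_of_le ht.1, uIcc_of_le (ht.1.trans ht.2)]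
    exact Icc_subset_Icc_right ht.2
  induction N with
  | zero => simpa [iterCaputoLeft] using (hstep 0 le_rfl y hy).symm
  | succ N ih =>
    have hcont' := (hac (N + 1) le_rfl).continuousOn
    rw [uIcc_of_le (hy.1.trans hy.2)] at hcont'
    have htop : EqOn (iterCaputoLeft α x (N + 1) f)
        (rlIntegral α x (iterCaputoLeft α x (N + 2) f)) (Ioo x y) := fun t ht => by
      rw [hstep (N + 1) le_rfl t ⟨ht.1.le, ht.2.le.trans hy.2⟩, iterCaputoLeft_succ α x N,
        caputoLeft_self, sub_zero]
    have hN : 0 < (N + 1) * α := by positivity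
    rw [ih (fun k hk => hac k (by omega)) hcont' (fun k hk => hstep k (by omega)),
      rlIntegral_congr htop, rlIntegral_rlIntegral hN hα0]
    · push_cast
      ring_nf
    · exact integrableOn_rlKernel_mul_of_continuousOn (add_pos hN hα0) hy.1
        (hcont.mono (Icc_subset_Icc_right hy.2))

theorem abs_rlIntegral_le {ν x y c d : ℝ} (hν : 0 < ν) {g : ℝ → ℝ}
    (hg : ∀ t ∈ Ioo x y, |g t| ≤ c + d * (t - x)) :
    |rlIntegral ν x g y| ≤ c * rlKernel (ν + 1) (y - x) + d * rlKernel (ν + 2) (y - x) := by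
  -- `rlKernel 1` and `rlKernel 2` are `1` and `t - x` right of `x`, so the bound on `g` is
  -- integrated by the semigroup law.
  set B : ℝ → ℝ := fun t => c * (rlKernel ν (y - t) * rlKernel 1 (t - x)) +
    d * (rlKernel ν (y - t) * rlKernel 2 (t - x)) with hB
  have hint₁ := (integrable_rlKernel_mul_rlKernel hν one_pos x y).const_mul c
  have hint₂ := (integrable_rlKernel_mul_rlKernel hν two_pos x y).const_mul d
  have hle : ∀ t ∈ Ioi x, ‖rlKernel ν (y - t) * g t‖ ≤ B t := fun t ht => by
    have htx : 0 < t - x := sub_pos.2 ht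
    rcases lt_or_ge t y with hty | hty
    · calc ‖rlKernel ν (y - t) * g t‖ = rlKernel ν (y - t) * |g t| := by
            rw [norm_mul, Real.norm_of_nonneg (rlKernel_nonneg hν _), Real.norm_eq_abs]
        _ ≤ rlKernel ν (y - t) * (c + d * (t - x)) :=
            mul_le_mul_of_nonneg_left (hg t ⟨ht, hty⟩) (rlKernel_nonneg hν _)
        _ = B t := by
            simp only [hB, rlKernel_of_pos _ htx, sub_self, Real.rpow_zero, Real.Gamma_one, div_one,
              mul_one, show (2 : ℝ) - 1 = 1 by norm_num, Real.rpow_one, Real.Gamma_two]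
            ring
    · simp [hB, rlKernel_of_nonpos ν (sub_nonpos.2 hty)]
  have hsupp : ∀ t ∉ Ioi x, B t = 0 := fun t ht => by
    simp [hB, rlKernel_of_nonpos _ (sub_nonpos.2 (notMem_Ioi.1 ht))]
  calc |rlIntegral ν x g y| ≤ ∫ t in Ioi x, B t :=
        norm_integral_le_of_norm_le (hint₁.add hint₂).integrableOn
          ((ae_restrict_iff' measurableSet_Ioi).2 (ae_of_all _ hle))
    _ = ∫ t, B t := setIntegral_eq_integral_of_forall_compl_eq_zero hsupp
    _ = c * rlKernel (ν + 1) (y - x) + d * rlKernel (ν + 2) (y - x) := by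
        rw [hB, integral_add hint₁ hint₂, integral_const_mul, integral_const_mul,
          integral_rlKernel_mul_rlKernel hν one_pos, integral_rlKernel_mul_rlKernel hν two_pos]

/-! ### The modulus of continuity -/

lemma modulusOn_nonneg (s : Set ℝ) (g : ℝ → ℝ) (δ : ℝ) : 0 ≤ modulusOn s g δ :=
  Real.sSup_nonneg fun _ ⟨_, _, _, _, _, hr⟩ => hr ▸ abs_nonneg _

lemma abs_sub_le_modulusOn {s : Set ℝ} {g : ℝ → ℝ} {δ C y z : ℝ} (hg : ∀ t ∈ s, |g t| ≤ C)
    (hy : y ∈ s) (hz : z ∈ s) (hyz : |y - z| ≤ δ) : |g y - g z| ≤ modulusOn s g δ := by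
  refine le_csSup ⟨C + C, ?_⟩ ⟨y, hy, z, hz, hyz, rfl⟩
  rintro _ ⟨u, hu, v, hv, -, rfl⟩
  exact (abs_sub _ _).trans (add_le_add (hg u hu) (hg v hv))

lemma abs_sub_le_modulusOn_mul {s : Set ℝ} (hs : Convex ℝ s) {g : ℝ → ℝ} {δ C y z : ℝ}
    (hg : ∀ t ∈ s, |g t| ≤ C) (hδ : 0 < δ) (hy : y ∈ s) (hz : z ∈ s) :
    |g y - g z| ≤ modulusOn s g δ * (1 + |y - z| / δ) := by
  set n : ℕ := ⌊|y - z| / δ⌋₊ + 1 with hn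
  have hn0 : (0 : ℝ) < n := by positivity
  set p : ℕ → ℝ := fun i => z + (i / n : ℝ) • (y - z) with hp
  have hp0 : p 0 = z := by simp [hp]
  have hpn : p n = y := by simp [hp]
  have hmem : ∀ i ≤ n, p i ∈ s := fun i hi =>
    hs.add_smul_sub_mem hz hy ⟨by positivity, (div_le_one hn0).2 (by exact_mod_cast hi)⟩
  have hstep : ∀ i < n, dist (g (p i)) (g (p (i + 1))) ≤ modulusOn s g δ := fun i hi => by
    have hlen : p i - p (i + 1) = -((y - z) / n) := by
      simp only [hp, smul_eq_mul, Nat.cast_add, Nat.cast_one]; ring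
    refine abs_sub_le_modulusOn hg (hmem i hi.le) (hmem (i + 1) hi) ?_
    rw [hlen, abs_neg, abs_div, abs_of_pos hn0, div_le_iff₀ hn0, mul_comm, ← div_le_iff₀ hδ, hn]
    exact_mod_cast (Nat.lt_floor_add_one _).le
  have hcount : (n : ℝ) ≤ 1 + |y - z| / δ := by
    have := Nat.floor_le (show 0 ≤ |y - z| / δ by positivity)
    rw [hn]; push_cast; linarith
  calc |g y - g z| = dist (g (p 0)) (g (p n)) := by rw [hp0, hpn, dist_comm, Real.dist_eq]
    _ ≤ ∑ _i ∈ Finset.range n, modulusOn s g δ := dist_le_range_sum_of_dist_le n (hstep _)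
    _ = modulusOn s g δ * n := by rw [Finset.sum_const, Finset.card_range, nsmul_eq_mul, mul_comm]
    _ ≤ modulusOn s g δ * (1 + |y - z| / δ) :=
        mul_le_mul_of_nonneg_left hcount (modulusOn_nonneg s g δ)

lemma modulusOn_comp_neg (a b : ℝ) (g : ℝ → ℝ) (δ : ℝ) :
    modulusOn (Icc (-b) (-a)) (fun y => g (-y)) δ = modulusOn (Icc a b) g δ := by
  have hneg : ∀ {u : ℝ}, u ∈ Icc (-b) (-a) ↔ -u ∈ Icc a b := fun {u} => by
    simp only [mem_Icc, neg_le, le_neg, and_comm]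
  unfold modulusOn
  congr 1
  ext r
  constructor
  · rintro ⟨y, hy, z, hz, h, rfl⟩
    exact ⟨-y, hneg.1 hy, -z, hneg.1 hz, by rwa [neg_sub_neg, abs_sub_comm], rfl⟩
  · rintro ⟨y, hy, z, hz, h, rfl⟩
    exact ⟨-y, hneg.2 (by rwa [neg_neg]), -z, hneg.2 (by rwa [neg_neg]),
      by rwa [neg_sub_neg, abs_sub_comm], by simp only [neg_neg]⟩

lemma caputoModulus_nonneg (α a b x : ℝ) (k : ℕ) (f : ℝ → ℝ) (δ : ℝ) :
    0 ≤ caputoModulus α a b x k f δ :=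
  (modulusOn_nonneg _ _ _).trans (le_max_left _ _)

/-! ### The remainder of the fractional Taylor formula -/

/-- The size at distance `d` from its anchor of a fractional integral of order `ν` of a function
that vanishes at the anchor and has modulus of continuity `ω` at scale `δ`. -/
noncomputable def fracTaylorBound (ω ν δ d : ℝ) : ℝ :=
  ω / Real.Gamma (ν + 1) * (d ^ ν + d ^ (ν + 1) / (δ * (ν + 1)))

lemma fracTaylorBound_nonneg {ω ν δ d : ℝ} (hω : 0 ≤ ω) (hν : 0 < ν) (hδ : 0 < δ) (hd : 0 ≤ d) :
    0 ≤ fracTaylorBound ω ν δ d := by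
  have : 0 < Real.Gamma (ν + 1) := Real.Gamma_pos_of_pos (by positivity)
  unfold fracTaylorBound
  positivity

lemma fracTaylorBound_mono {ω ω' ν δ d d' : ℝ} (hω : 0 ≤ ω) (hωω' : ω ≤ ω')
    (hν : 0 < ν) (hδ : 0 < δ) (hd : 0 ≤ d) (hdd' : d ≤ d') :
    fracTaylorBound ω ν δ d ≤ fracTaylorBound ω' ν δ d' := by
  have : 0 < Real.Gamma (ν + 1) := Real.Gamma_pos_of_pos (by positivity)
  have hω' := hω.trans hωω'
  unfold fracTaylorBound
  gcongr

lemma abs_rlIntegral_le_fracTaylorBound {ν x b δ y : ℝ} (hν : 0 < ν) (hδ : 0 < δ) {g : ℝ → ℝ}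
    (hg : ContinuousOn g (Icc x b)) (hgx : g x = 0) (hy : y ∈ Icc x b) :
    |rlIntegral ν x g y| ≤ fracTaylorBound (modulusOn (Icc x b) g δ) ν δ (y - x) := by
  obtain ⟨C, hC⟩ := isCompact_Icc.exists_bound_of_continuousOn hg
  set ω := modulusOn (Icc x b) g δ
  have hgrowth : ∀ t ∈ Ioo x y, |g t| ≤ ω + ω / δ * (t - x) := fun t ht => by
    have hmod := abs_sub_le_modulusOn_mul (convex_Icc x b) hC hδ
      (⟨ht.1.le, ht.2.le.trans hy.2⟩ : t ∈ Icc x b) ⟨le_rfl, hy.1.trans hy.2⟩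
    rw [hgx, sub_zero, abs_of_pos (sub_pos.2 ht.1)] at hmod
    exact hmod.trans_eq (by ring)
  have hd := sub_nonneg.2 hy.1
  have hν1 : 0 < ν + 1 := by positivity
  calc |rlIntegral ν x g y|
      ≤ ω * rlKernel (ν + 1) (y - x) + ω / δ * rlKernel (ν + 2) (y - x) :=
        abs_rlIntegral_le hν hgrowth
    _ = fracTaylorBound ω ν δ (y - x) := by
        have hΓ := (Real.Gamma_pos_of_pos hν1).ne'
        rw [show ν + 2 = ν + 1 + 1 by ring, rlKernel_add_one hν hd, rlKernel_add_one hν1 hd,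
          Real.Gamma_add_one hν1.ne', fracTaylorBound]
        field_simp

theorem abs_sub_le_of_iterCaputoLeft {α x b δ : ℝ} (hα0 : 0 < α) (hα1 : α < 1) (hδ : 0 < δ)
    {f : ℝ → ℝ} {N : ℕ}
    (hac : ∀ k ≤ N, AbsolutelyContinuousOnInterval (iterCaputoLeft α x k f) x b)
    (hcont : ContinuousOn (iterCaputoLeft α x (N + 1) f) (Icc x b)) {y : ℝ} (hy : y ∈ Icc x b) :
    |f y - f x| ≤ fracTaylorBound (modulusOn (Icc x b) (iterCaputoLeft α x (N + 1) f) δ)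
      ((N + 1) * α) δ (y - x) := by
  rw [sub_eq_rlIntegral_iterCaputoLeft hα0 hα1 hac hcont hy]
  refine abs_rlIntegral_le_fracTaylorBound (by positivity) hδ hcont ?_ hy
  rw [iterCaputoLeft_succ, caputoLeft_self]

lemma absolutelyContinuousOnInterval_comp_neg {f : ℝ → ℝ} {a b : ℝ}
    (hf : AbsolutelyContinuousOnInterval f a b) :
    AbsolutelyContinuousOnInterval (fun t => f (-t)) (-b) (-a) := by
  have hneg : ∀ {u}, u ∈ uIcc (-b) (-a) → -u ∈ uIcc a b := fun {u} hu => by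
    rwa [uIcc_comm, ← neg_uIcc, Set.mem_neg] at hu
  rw [absolutelyContinuousOnInterval_iff] at hf ⊢
  intro ε hε
  obtain ⟨δ, hδ, hfδ⟩ := hf ε hε
  refine ⟨δ, hδ, fun E hE hlen => ?_⟩
  refine hfδ (E.1, fun i => (-(E.2 i).1, -(E.2 i).2)) ⟨fun i hi => ?_, fun i hi j hj hij => ?_⟩ ?_
  · exact ⟨hneg (hE.1 i hi).1, hneg (hE.1 i hi).2⟩
  · have hdisj := hE.2 hi hj hij
    simp only [Function.onFun, uIoc, Ioc_disjoint_Ioc, max_neg_neg, min_neg_neg] at hdisj ⊢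
    linarith
  · simpa only [dist_neg_neg] using hlen

lemma caputoLeft_comp_neg (α x : ℝ) (g : ℝ → ℝ) :
    caputoLeft α (-x) (fun t => g (-t)) = fun y => caputoRight α x g (-y) := by
  ext y
  rcases le_or_gt (-x) y with h | h
  · have hderiv : EqOn (fun t => (y - t) ^ (-α) * deriv (fun s => g (-s)) t)
        (fun t => -((-t - -y) ^ (-α) * deriv g (-t))) (uIcc (-x) y) := fun t _ => by
      simp only [deriv_comp_neg, mul_neg, neg_sub_neg]
    rw [caputoLeft, caputoRight, if_pos h, if_pos (neg_le.1 h),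
      intervalIntegral.integral_congr hderiv, intervalIntegral.integral_neg,
      intervalIntegral.integral_comp_neg fun t => (t - -y) ^ (-α) * deriv g t, neg_neg]
    ring
  · rw [caputoLeft, caputoRight, if_neg h.not_ge, if_neg (by linarith)]

lemma iterCaputoLeft_comp_neg (α x : ℝ) (k : ℕ) (f : ℝ → ℝ) :
    iterCaputoLeft α (-x) k (fun t => f (-t)) = fun y => iterCaputoRight α x k f (-y) := by
  induction k with
  | zero => rfl
  | succ k ih => rw [iterCaputoLeft_succ, ih, caputoLeft_comp_neg, iterCaputoRight_succ]

theorem abs_sub_le_of_iterCaputoRight {α a x δ : ℝ} (hα0 : 0 < α) (hα1 : α < 1) (hδ : 0 < δ)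
    {f : ℝ → ℝ} {N : ℕ}
    (hac : ∀ k ≤ N, AbsolutelyContinuousOnInterval (iterCaputoRight α x k f) a x)
    (hcont : ContinuousOn (iterCaputoRight α x (N + 1) f) (Icc a x)) {y : ℝ} (hy : y ∈ Icc a x) :
    |f y - f x| ≤ fracTaylorBound (modulusOn (Icc a x) (iterCaputoRight α x (N + 1) f) δ)
      ((N + 1) * α) δ (x - y) := by
  have hac' : ∀ k ≤ N,
      AbsolutelyContinuousOnInterval (iterCaputoLeft α (-x) k fun t => f (-t)) (-x) (-a) :=
    fun k hk => by
      rw [iterCaputoLeft_comp_neg]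
      exact absolutelyContinuousOnInterval_comp_neg (hac k hk)
  have hcont' : ContinuousOn (iterCaputoLeft α (-x) (N + 1) fun t => f (-t)) (Icc (-x) (-a)) := by
    rw [iterCaputoLeft_comp_neg]
    exact hcont.comp continuousOn_neg fun t ht => ⟨le_neg.1 ht.2, neg_le.1 ht.1⟩
  have hleft := abs_sub_le_of_iterCaputoLeft hα0 hα1 hδ hac' hcont'
    ⟨neg_le_neg hy.2, neg_le_neg hy.1⟩
  simpa only [iterCaputoLeft_comp_neg, modulusOn_comp_neg, neg_neg, neg_sub_neg] using hleft

theorem abs_sub_le_of_caputoModulus {α a b x δ : ℝ} (hα0 : 0 < α) (hα1 : α < 1) (hδ : 0 < δ)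
    (hx : x ∈ Icc a b) {f : ℝ → ℝ} {N : ℕ} (hfac : AbsolutelyContinuousOnInterval f a b)
    (hLac : ∀ k : ℕ, 1 ≤ k → k ≤ N → AbsolutelyContinuousOnInterval (iterCaputoLeft α x k f) x b)
    (hRac : ∀ k : ℕ, 1 ≤ k → k ≤ N → AbsolutelyContinuousOnInterval (iterCaputoRight α x k f) a x)
    (hLcont : ContinuousOn (iterCaputoLeft α x (N + 1) f) (Icc x b))
    (hRcont : ContinuousOn (iterCaputoRight α x (N + 1) f) (Icc a x)) {y : ℝ} (hy : y ∈ Icc a b) :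
    |f y - f x| ≤ fracTaylorBound (caputoModulus α a b x (N + 1) f δ) ((N + 1) * α) δ |y - x| := by
  have hν : 0 < (N + 1) * α := by positivity
  have hab := hx.1.trans hx.2
  rcases le_total x y with hxy | hyx
  · have hac : ∀ k ≤ N, AbsolutelyContinuousOnInterval (iterCaputoLeft α x k f) x b := by
      rintro (_ | k) hk
      · refine hfac.mono ?_
        rw [uIcc_of_le hx.2, uIcc_of_le hab]
        exact Icc_subset_Icc_left hx.1
      · exact hLac _ k.succ_pos hk
    rw [abs_of_nonneg (sub_nonneg.2 hxy)]
    exact (abs_sub_le_of_iterCaputoLeft hα0 hα1 hδ hac hLcont ⟨hxy, hy.2⟩).trans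
      (fracTaylorBound_mono (modulusOn_nonneg _ _ _) (le_max_left _ _) hν hδ
        (sub_nonneg.2 hxy) le_rfl)
  · have hac : ∀ k ≤ N, AbsolutelyContinuousOnInterval (iterCaputoRight α x k f) a x := by
      rintro (_ | k) hk
      · refine hfac.mono ?_
        rw [uIcc_of_le hx.1, uIcc_of_le hab]
        exact Icc_subset_Icc_right hx.2
      · exact hRac _ k.succ_pos hk
    rw [abs_sub_comm y, abs_of_nonneg (sub_nonneg.2 hyx)]
    exact (abs_sub_le_of_iterCaputoRight hα0 hα1 hδ hac hRcont ⟨hy.1, hyx⟩).trans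
      (fracTaylorBound_mono (modulusOn_nonneg _ _ _) (le_max_right _ _) hν hδ
        (sub_nonneg.2 hyx) le_rfl)

/-! ### The activation function -/

lemma sigmoidGen_neg (m : ℕ) (t : ℝ) : sigmoidGen m (-t) = -sigmoidGen m t := by
  rw [sigmoidGen, sigmoidGen, (even_two_mul m).neg_pow, neg_div]

lemma activation_neg (m : ℕ) (t : ℝ) : activation m (-t) = activation m t := by
  rw [activation, activation, show -t + 1 = -(t - 1) by ring, show -t - 1 = -(t + 1) by ring,
    sigmoidGen_neg, sigmoidGen_neg, neg_sub_neg]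

lemma one_add_pow_two_mul_pos (m : ℕ) (t : ℝ) : 0 < 1 + t ^ (2 * m) :=
  add_pos_of_pos_of_nonneg one_pos ((even_two_mul m).pow_nonneg t)

lemma hasDerivAt_sigmoidGen {m : ℕ} (hm : m ≠ 0) (t : ℝ) :
    HasDerivAt (sigmoidGen m) ((1 + t ^ (2 * m)) ^ (-(1 / (2 * (m : ℝ)) + 1))) t := by
  have hm' : (m : ℝ) ≠ 0 := Nat.cast_ne_zero.2 hm
  have hpos := one_add_pow_two_mul_pos m t
  have hroot := Real.rpow_pos_of_pos hpos (1 / (2 * (m : ℝ)))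
  have hbase : HasDerivAt (fun t : ℝ => 1 + t ^ (2 * m)) ((2 * m : ℕ) * t ^ (2 * m - 1)) t :=
    (hasDerivAt_pow (2 * m) t).const_add 1
  refine ((hasDerivAt_id t).div (hbase.rpow_const (p := 1 / (2 * (m : ℝ))) (Or.inl hpos.ne'))
    hroot.ne').congr_deriv ?_
  have hpow : t ^ (2 * m) = t * t ^ (2 * m - 1) := (mul_pow_sub_one (by omega) t).symm
  rw [Real.rpow_sub_one hpos.ne', Real.rpow_neg hpos.le, Real.rpow_add_one hpos.ne']
  generalize (1 + t ^ (2 * m)) ^ (1 / (2 * (m : ℝ))) = r at *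
  rw [hpow] at hpos ⊢
  have := hpos.ne'
  have := hroot.ne'
  simp only [id]
  push_cast
  field_simp
  ring

lemma sigmoidGen_strictMono {m : ℕ} (hm : m ≠ 0) : StrictMono (sigmoidGen m) :=
  strictMono_of_deriv_pos fun t => by
    rw [(hasDerivAt_sigmoidGen hm t).deriv]
    exact Real.rpow_pos_of_pos (one_add_pow_two_mul_pos m t) _

lemma activation_pos {m : ℕ} (hm : m ≠ 0) (t : ℝ) : 0 < activation m t :=
  mul_pos (by norm_num) (sub_pos.2 (sigmoidGen_strictMono hm (by linarith)))

lemma activation_antitoneOn {m : ℕ} (hm : m ≠ 0) : AntitoneOn (activation m) (Ici 0) := by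
  have hderiv : ∀ t, HasDerivAt (activation m)
      (1 / 4 * ((1 + (t + 1) ^ (2 * m)) ^ (-(1 / (2 * (m : ℝ)) + 1)) -
        (1 + (t - 1) ^ (2 * m)) ^ (-(1 / (2 * (m : ℝ)) + 1)))) t := fun t =>
    (((hasDerivAt_sigmoidGen hm (t + 1)).comp_add_const t 1).sub
      ((hasDerivAt_sigmoidGen hm (t - 1)).comp_sub_const t 1)).const_mul (1 / 4)
  refine antitoneOn_of_deriv_nonpos (convex_Ici 0)
    (fun t _ => (hderiv t).continuousAt.continuousWithinAt)
    (fun t _ => (hderiv t).differentiableAt.differentiableWithinAt) fun t ht => ?_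
  rw [interior_Ici, mem_Ioi] at ht
  have hpow : (t - 1) ^ (2 * m) ≤ (t + 1) ^ (2 * m) := by
    rw [pow_mul, pow_mul]
    exact pow_le_pow_left₀ (sq_nonneg _) (by nlinarith) _
  have hexp : -(1 / (2 * (m : ℝ)) + 1) ≤ 0 := neg_nonpos.2 (by positivity)
  rw [(hderiv t).deriv]
  exact mul_nonpos_of_nonneg_of_nonpos (by norm_num) <| sub_nonpos.2 <|
    Real.rpow_le_rpow_of_nonpos (one_add_pow_two_mul_pos m (t - 1)) (add_le_add_right hpow 1) hexp

lemma activation_one (m : ℕ) :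
    activation m 1 = 1 / (2 * (1 + 4 ^ m : ℝ) ^ (1 / (2 * (m : ℝ)))) := by
  rw [activation, sigmoidGen, sigmoidGen, sub_self, zero_div, sub_zero, one_add_one_eq_two, pow_mul,
    show (2 : ℝ) ^ 2 = 4 by norm_num]
  ring

lemma activation_one_le {m : ℕ} (hm : m ≠ 0) {t : ℝ} (ht : |t| ≤ 1) :
    activation m 1 ≤ activation m t := by
  have hanti := activation_antitoneOn hm (abs_nonneg t) (mem_Ici.2 zero_le_one) ht
  rcases abs_choice t with h | h <;> rw [h] at hanti
  · exact hanti
  · rwa [activation_neg] at hanti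

lemma pow_two_mul_rpow {m : ℕ} (hm : m ≠ 0) (t : ℝ) :
    (t ^ (2 * m)) ^ (1 / (2 * (m : ℝ))) = |t| := by
  rw [← (even_two_mul m).pow_abs, one_div, show 2 * (m : ℝ) = (2 * m : ℕ) by push_cast; rfl,
    Real.pow_rpow_inv_natCast (abs_nonneg t) (by omega)]

lemma sigmoidGen_le_one {m : ℕ} (hm : m ≠ 0) (t : ℝ) : sigmoidGen m t ≤ 1 := by
  rw [sigmoidGen, div_le_one (Real.rpow_pos_of_pos (one_add_pow_two_mul_pos m t) _)]
  calc t ≤ (t ^ (2 * m)) ^ (1 / (2 * (m : ℝ))) :=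
        (le_abs_self t).trans_eq (pow_two_mul_rpow hm t).symm
    _ ≤ (1 + t ^ (2 * m)) ^ (1 / (2 * (m : ℝ))) :=
        Real.rpow_le_rpow ((even_two_mul m).pow_nonneg t) (by linarith) (by positivity)

lemma activation_one_le_one {m : ℕ} (hm : m ≠ 0) : activation m 1 ≤ 1 :=
  calc activation m 1 = 1 / 4 * sigmoidGen m 2 := by
        rw [activation, sub_self, one_add_one_eq_two, sigmoidGen, sigmoidGen, zero_div, sub_zero]
    _ ≤ 1 := by linarith [sigmoidGen_le_one hm 2]

lemma one_sub_sigmoidGen_le {m : ℕ} (hm : m ≠ 0) {t : ℝ} (ht : 0 < t) :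
    1 - sigmoidGen m t ≤ 1 / (2 * m * t ^ (2 * m)) := by
  have hm' : (1 : ℝ) ≤ m := Nat.one_le_cast.2 (Nat.one_le_iff_ne_zero.2 hm)
  have hp : 1 / (2 * (m : ℝ)) ≤ 1 := (div_le_one (by positivity)).2 (by linarith)
  have hpow : 0 < t ^ (2 * m) := by positivity
  set q := (1 + 1 / t ^ (2 * m)) ^ (1 / (2 * (m : ℝ)))
  have hq : 0 < q := by positivity
  have hden : (1 + t ^ (2 * m)) ^ (1 / (2 * (m : ℝ))) = t * q := by
    rw [show 1 + t ^ (2 * m) = t ^ (2 * m) * (1 + 1 / t ^ (2 * m)) by field_simp; ring,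
      Real.mul_rpow hpow.le (by positivity), pow_two_mul_rpow hm, abs_of_pos ht]
  have hbernoulli : q ≤ 1 + 1 / (2 * (m : ℝ)) * (1 / t ^ (2 * m)) :=
    rpow_one_add_le_one_add_mul_self (by linarith [one_div_pos.2 hpow]) (by positivity) hp
  calc 1 - sigmoidGen m t = 1 - q⁻¹ := by
        rw [sigmoidGen, hden, ← div_div, div_self ht.ne', one_div]
    _ ≤ q - 1 := (Real.one_sub_inv_le_log_of_pos hq).trans (Real.log_le_sub_one_of_pos hq)
    _ ≤ 1 / (2 * (m : ℝ)) * (1 / t ^ (2 * m)) := by linarith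
    _ = 1 / (2 * m * t ^ (2 * m)) := by rw [div_mul_div_comm, one_mul]

lemma sum_range_activation (m : ℕ) (t : ℝ) (n : ℕ) :
    ∑ j ∈ Finset.range n, activation m (t + j) =
      1 / 4 * ((sigmoidGen m (t + n) + sigmoidGen m (t + n - 1)) -
        (sigmoidGen m t + sigmoidGen m (t - 1))) := by
  induction n with
  | zero => simp
  | succ n ih =>
    rw [Finset.sum_range_succ, ih, activation, Nat.cast_succ, ← add_assoc, add_sub_cancel_right]
    ring

lemma sum_range_activation_le {m : ℕ} (hm : m ≠ 0) {t : ℝ} (ht : 1 < t) (n : ℕ) :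
    ∑ j ∈ Finset.range n, activation m (t + j) ≤ 1 / (4 * m * (t - 1) ^ (2 * m)) := by
  have htop := sigmoidGen_le_one hm (t + n)
  have htop' := sigmoidGen_le_one hm (t + n - 1)
  have hmono := (sigmoidGen_strictMono hm).monotone (sub_one_lt t).le
  calc ∑ j ∈ Finset.range n, activation m (t + j) ≤ 1 / 2 * (1 - sigmoidGen m (t - 1)) := by
        rw [sum_range_activation]; linarith
    _ ≤ 1 / 2 * (1 / (2 * m * (t - 1) ^ (2 * m))) := by
        gcongr; exact one_sub_sigmoidGen_le hm (sub_pos.2 ht)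
    _ = 1 / (4 * m * (t - 1) ^ (2 * m)) := by rw [div_mul_div_comm]; ring

/-! ### Weights far from the centre -/

lemma sum_Ico_activation_le {m : ℕ} (hm : m ≠ 0) {z : ℝ} {p : ℤ} (hp : z + 1 < p) (q : ℤ) :
    ∑ k ∈ Finset.Ico p q, activation m (z - k) ≤ 1 / (4 * m * (p - z - 1) ^ (2 * m)) := by
  calc ∑ k ∈ Finset.Ico p q, activation m (z - k)
      = ∑ j ∈ Finset.range (q - p).toNat, activation m (p - z + j) := by
        rw [Int.Ico_eq_finset_map, Finset.sum_map]
        refine Finset.sum_congr rfl fun j _ => ?_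
        rw [← activation_neg]
        congr 1
        simp only [Function.Embedding.trans_apply, Nat.castEmbedding_apply, addLeftEmbedding_apply,
          Int.cast_add, Int.cast_natCast]
        ring
    _ ≤ 1 / (4 * m * (p - z - 1) ^ (2 * m)) := sum_range_activation_le hm (by linarith) _

lemma sum_activation_add_lt_le {m : ℕ} (hm : m ≠ 0) (A B : ℤ) (z : ℝ) {T : ℝ} (hT : 2 < T) :
    ∑ k ∈ Finset.Icc A B with z + T < ((k : ℤ) : ℝ), activation m (z - k) ≤
      1 / (4 * m * (T - 2) ^ (2 * m)) := by
  have hfloor : z + T < (⌊z + T⌋ + 1 : ℤ) := by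
    push_cast; exact Int.lt_floor_add_one _
  have hsub : (Finset.Icc A B).filter (fun k : ℤ => z + T < k) ⊆
      Finset.Ico (⌊z + T⌋ + 1) (B + 1) := fun k hk => by
    rw [Finset.mem_filter, Finset.mem_Icc, ← Int.floor_lt] at hk
    rw [Finset.mem_Ico]
    omega
  calc ∑ k ∈ Finset.Icc A B with z + T < ((k : ℤ) : ℝ), activation m (z - k)
      ≤ ∑ k ∈ Finset.Ico (⌊z + T⌋ + 1) (B + 1), activation m (z - k) :=
        Finset.sum_le_sum_of_subset_of_nonneg hsub fun _ _ _ => (activation_pos hm _).le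
    _ ≤ 1 / (4 * m * ((⌊z + T⌋ + 1 : ℤ) - z - 1) ^ (2 * m)) :=
        sum_Ico_activation_le hm (by linarith) _
    _ ≤ 1 / (4 * m * (T - 2) ^ (2 * m)) := by
        have : 0 < T - 2 := sub_pos.2 hT
        have := Nat.pos_of_ne_zero hm
        have hle : T - 2 ≤ (⌊z + T⌋ + 1 : ℤ) - z - 1 := by linarith
        gcongr

lemma activation_one_mul_sum_add_lt_le {m : ℕ} (hm : m ≠ 0) {A : ℤ} (B : ℤ) {z T : ℝ} (hT : 2 < T)
    (hA : (A : ℝ) ≤ z + 1) :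
    activation m 1 * ∑ k ∈ Finset.Icc A B with z + T < ((k : ℤ) : ℝ), activation m (z - k) ≤
      (∑ k ∈ Finset.Icc A B with z < ((k : ℤ) : ℝ), activation m (z - k)) *
        (1 / (4 * m * (T - 2) ^ (2 * m))) := by
  have : 0 < T - 2 := sub_pos.2 hT
  have hτ : 0 ≤ 1 / (4 * (m : ℝ) * (T - 2) ^ (2 * m)) := by positivity
  rcases le_or_gt (⌊z⌋ + 1) B with hB | hB
  · have hmem : ⌊z⌋ + 1 ∈ (Finset.Icc A B).filter fun k : ℤ => z < k := by
      refine Finset.mem_filter.2 ⟨Finset.mem_Icc.2 ⟨?_, hB⟩, ?_⟩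
      · rw [← Int.floor_add_one]; exact Int.le_floor.2 hA
      · exact_mod_cast Int.lt_floor_add_one z
    have hnear : |z - (⌊z⌋ + 1 : ℤ)| ≤ 1 := by
      rw [abs_le]; push_cast
      constructor <;> linarith [Int.floor_le z, Int.lt_floor_add_one z]
    have hside : activation m 1 ≤
        ∑ k ∈ Finset.Icc A B with z < ((k : ℤ) : ℝ), activation m (z - k) :=
      (activation_one_le hm hnear).trans <| Finset.single_le_sum
        (f := fun k : ℤ => activation m (z - k)) (fun _ _ => (activation_pos hm _).le) hmem
    exact mul_le_mul hside (sum_activation_add_lt_le hm A B z hT)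
      (Finset.sum_nonneg fun _ _ => (activation_pos hm _).le)
      ((activation_pos hm 1).le.trans hside)
  · have hempty : (Finset.Icc A B).filter (fun k : ℤ => z + T < k) = ∅ := by
      refine Finset.filter_false_of_mem fun k hk hzk => ?_
      have hkz : ⌊z⌋ < k := Int.floor_lt.2 (by linarith)
      have := (Finset.mem_Icc.1 hk).2
      omega
    rw [hempty, Finset.sum_empty, mul_zero]
    exact mul_nonneg (Finset.sum_nonneg fun _ _ => (activation_pos hm _).le) hτ

lemma sum_activation_add_lt_neg (m : ℕ) (A B : ℤ) (z c : ℝ) :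
    ∑ k ∈ Finset.Icc (-B) (-A) with -z + c < ((k : ℤ) : ℝ), activation m (-z - k) =
      ∑ k ∈ Finset.Icc A B with ((k : ℤ) : ℝ) < z - c, activation m (z - k) := by
  refine Finset.sum_equiv (Equiv.neg ℤ) (fun k => ?_) fun k _ => ?_
  · simp only [Finset.mem_filter, Finset.mem_Icc, Equiv.neg_apply, Int.cast_neg, neg_le, le_neg,
      and_comm (a := k ≤ -A)]
    exact and_congr_right fun _ => ⟨fun h => by linarith, fun h => by linarith⟩
  · rw [← activation_neg, Equiv.neg_apply, Int.cast_neg]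
    ring_nf

-- The two tails together may exceed the bound for a single one; comparing each of them with the
-- weight on its own side of `z` absorbs this factor of two into the total weight.
lemma activation_one_mul_sum_far_le {m : ℕ} (hm : m ≠ 0) {A B : ℤ} {z T : ℝ} (hT : 2 < T)
    (hA : (A : ℝ) ≤ z + 1) (hB : z - 1 ≤ B) :
    activation m 1 * ∑ k ∈ Finset.Icc A B with T < |z - ((k : ℤ) : ℝ)|, activation m (z - k) ≤
      (∑ k ∈ Finset.Icc A B, activation m (z - k)) * (1 / (4 * m * (T - 2) ^ (2 * m))) := by
  have : 0 < T - 2 := sub_pos.2 hT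
  set R := fun c : ℝ => ∑ k ∈ Finset.Icc A B with z + c < ((k : ℤ) : ℝ), activation m (z - k)
    with hR
  set L := fun c : ℝ => ∑ k ∈ Finset.Icc A B with ((k : ℤ) : ℝ) < z - c, activation m (z - k)
    with hL
  have hright : activation m 1 * R T ≤ R 0 * (1 / (4 * m * (T - 2) ^ (2 * m))) := by
    simpa only [hR, add_zero] using activation_one_mul_sum_add_lt_le hm B hT hA
  have hleft : activation m 1 * L T ≤ L 0 * (1 / (4 * m * (T - 2) ^ (2 * m))) := by
    have hB' : ((-B : ℤ) : ℝ) ≤ -z + 1 := by push_cast; linarith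
    simpa only [← sum_activation_add_lt_neg, add_zero, hL] using
      activation_one_mul_sum_add_lt_le hm (-A) hT hB'
  have hfar : ∑ k ∈ Finset.Icc A B with T < |z - ((k : ℤ) : ℝ)|, activation m (z - k) ≤
      R T + L T := by
    simp only [hR, hL, Finset.sum_filter, ← Finset.sum_add_distrib]
    refine Finset.sum_le_sum fun k _ => ?_
    have := activation_pos hm (z - k)
    grind
  have hsides : R 0 + L 0 ≤ ∑ k ∈ Finset.Icc A B, activation m (z - k) := by
    simp only [hR, hL, Finset.sum_filter, ← Finset.sum_add_distrib]
    refine Finset.sum_le_sum fun k _ => ?_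
    have := activation_pos hm (z - k)
    grind
  calc activation m 1 * ∑ k ∈ Finset.Icc A B with T < |z - ((k : ℤ) : ℝ)|, activation m (z - k)
      ≤ activation m 1 * (R T + L T) :=
        mul_le_mul_of_nonneg_left hfar (activation_pos hm 1).le
    _ ≤ (R 0 + L 0) * (1 / (4 * m * (T - 2) ^ (2 * m))) := by
        rw [mul_add, add_mul]; exact add_le_add hright hleft
    _ ≤ (∑ k ∈ Finset.Icc A B, activation m (z - k)) * (1 / (4 * m * (T - 2) ^ (2 * m))) :=
        mul_le_mul_of_nonneg_right hsides (by positivity)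

/-! ### The neural network operator -/

lemma abs_sum_mul_div_sum_sub_le {ι : Type*} {s : Finset ι} {w v : ι → ℝ} {c E₁ E₂ : ℝ}
    (p : ι → Prop) [DecidablePred p] (hw : ∀ i ∈ s, 0 ≤ w i) (hpos : 0 < ∑ i ∈ s, w i)
    (hE₁ : 0 ≤ E₁) (hnear : ∀ i ∈ s, ¬p i → |v i - c| ≤ E₁) (hfar : ∀ i ∈ s, p i → |v i - c| ≤ E₂) :
    |(∑ i ∈ s, v i * w i) / ∑ i ∈ s, w i - c| ≤
      E₁ + E₂ * ((∑ i ∈ s with p i, w i) / ∑ i ∈ s, w i) := by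
  have hcentre : (∑ i ∈ s, v i * w i) / ∑ i ∈ s, w i - c =
      (∑ i ∈ s, (v i - c) * w i) / ∑ i ∈ s, w i := by
    simp_rw [sub_mul, Finset.sum_sub_distrib, ← Finset.mul_sum]
    rw [sub_div, mul_div_cancel_right₀ _ hpos.ne']
  have hsum : |∑ i ∈ s, (v i - c) * w i| ≤ E₁ * ∑ i ∈ s, w i + E₂ * ∑ i ∈ s with p i, w i := by
    refine (Finset.abs_sum_le_sum_abs _ _).trans ?_
    rw [Finset.sum_filter, Finset.mul_sum, Finset.mul_sum, ← Finset.sum_add_distrib]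
    refine Finset.sum_le_sum fun i hi => ?_
    have hE₁w := mul_nonneg hE₁ (hw i hi)
    rw [abs_mul, abs_of_nonneg (hw i hi)]
    split_ifs with h
    · linarith [mul_le_mul_of_nonneg_right (hfar i hi h) (hw i hi)]
    · linarith [mul_le_mul_of_nonneg_right (hnear i hi h) (hw i hi)]
  rw [hcentre, abs_div, abs_of_pos hpos, div_le_iff₀ hpos, add_mul, mul_assoc,
    div_mul_cancel₀ _ hpos.ne']
  exact hsum

lemma intCast_div_mem_Icc {a b : ℝ} {n : ℕ} (hn : 0 < n) {k : ℤ}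
    (hk : k ∈ Finset.Icc ⌈(n : ℝ) * a⌉ ⌊(n : ℝ) * b⌋) : (k : ℝ) / n ∈ Icc a b := by
  obtain ⟨hak, hkb⟩ := Finset.mem_Icc.1 hk
  have hn' : (0 : ℝ) < n := Nat.cast_pos.2 hn
  rw [mem_Icc, le_div_iff₀' hn', div_le_iff₀' hn']
  exact ⟨Int.ceil_le.1 hak, Int.le_floor.1 hkb⟩

lemma sum_far_activation_div_sum_le {m n : ℕ} (hm : m ≠ 0) {a b x T : ℝ} (hx : x ∈ Icc a b)
    (hT : 2 < T) (hab : ⌈(n : ℝ) * a⌉ ≤ ⌊(n : ℝ) * b⌋) :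
    (∑ k ∈ Finset.Icc ⌈(n : ℝ) * a⌉ ⌊(n : ℝ) * b⌋ with T < |(n : ℝ) * x - ((k : ℤ) : ℝ)|,
        activation m (n * x - k)) /
      ∑ k ∈ Finset.Icc ⌈(n : ℝ) * a⌉ ⌊(n : ℝ) * b⌋, activation m (n * x - k) ≤
    1 / (4 * m * (T - 2) ^ (2 * m)) / activation m 1 := by
  have hna := mul_le_mul_of_nonneg_left hx.1 n.cast_nonneg
  have hnb := mul_le_mul_of_nonneg_left hx.2 n.cast_nonneg
  have hpos : 0 < ∑ k ∈ Finset.Icc ⌈(n : ℝ) * a⌉ ⌊(n : ℝ) * b⌋, activation m (n * x - k) :=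
    Finset.sum_pos (fun _ _ => activation_pos hm _) (Finset.nonempty_Icc.2 hab)
  rw [div_le_div_iff₀ hpos (activation_pos hm 1), mul_comm, mul_comm (1 / _)]
  exact activation_one_mul_sum_far_le hm hT (by linarith [Int.ceil_lt_add_one ((n : ℝ) * a)])
    (by linarith [Int.sub_one_lt_floor ((n : ℝ) * b)])

theorem abs_neuralOp_sub_le {m n : ℕ} (hm : m ≠ 0) {a b x d E₁ E₂ : ℝ} {f : ℝ → ℝ}
    (hx : x ∈ Icc a b) (hab : ⌈(n : ℝ) * a⌉ ≤ ⌊(n : ℝ) * b⌋) (hd : 2 < n * d)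
    (hnear : ∀ y ∈ Icc a b, |y - x| ≤ d → |f y - f x| ≤ E₁)
    (hfar : ∀ y ∈ Icc a b, |f y - f x| ≤ E₂) :
    |neuralOp m a b n f x - f x| ≤
      E₁ + E₂ * (1 / (4 * m * (n * d - 2) ^ (2 * m)) / activation m 1) := by
  have hn : 0 < n := by
    rcases n.eq_zero_or_pos with rfl | hn
    · norm_num at hd
    · exact hn
  have hn' : (0 : ℝ) < n := Nat.cast_pos.2 hn
  have hd0 : 0 < d := pos_of_mul_pos_right (two_pos.trans hd) hn'.le
  have hE₁ : 0 ≤ E₁ := (abs_nonneg _).trans (hnear x hx (by rw [sub_self, abs_zero]; exact hd0.le))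
  have hE₂ : 0 ≤ E₂ := (abs_nonneg _).trans (hfar x hx)
  have hclose : ∀ k : ℤ, |(n : ℝ) * x - k| ≤ n * d → |(k : ℝ) / n - x| ≤ d := fun k hk => by
    rw [show (k : ℝ) / n - x = -((n * x - k) / n) by field_simp; ring, abs_neg, abs_div,
      abs_of_pos hn', div_le_iff₀' hn']
    exact hk
  refine (abs_sum_mul_div_sum_sub_le (fun k : ℤ => n * d < |(n : ℝ) * x - k|)
    (fun _ _ => (activation_pos hm _).le)
    (Finset.sum_pos (fun _ _ => activation_pos hm _) (Finset.nonempty_Icc.2 hab)) hE₁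
    (fun k hk hkd => hnear _ (intCast_div_mem_Icc hn hk) (hclose k (not_lt.1 hkd)))
    (fun k hk _ => hfar _ (intCast_div_mem_Icc hn hk))).trans ?_
  exact add_le_add_right
    (mul_le_mul_of_nonneg_left (sum_far_activation_div_sum_le hm hx hd hab) hE₂) E₁

lemma eventually_ceil_mul_le_floor_mul {a b : ℝ} (hab : a < b) :
    ∀ᶠ n : ℕ in atTop, ⌈(n : ℝ) * a⌉ ≤ ⌊(n : ℝ) * b⌋ := by
  filter_upwards [(tendsto_natCast_atTop_atTop (R := ℝ)).eventually_ge_atTop (1 / (b - a))]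
    with n hn
  have hlen := (div_le_iff₀ (sub_pos.2 hab)).1 hn
  exact Int.le_floor.2 (by linarith [Int.ceil_lt_add_one ((n : ℝ) * a)])

theorem tendsto_neuralOp {m : ℕ} (hm : m ≠ 0) {a b x C : ℝ} {f : ℝ → ℝ} (hab : a < b)
    (hx : x ∈ Icc a b) (hcont : ContinuousWithinAt f (Icc a b) x)
    (hbdd : ∀ y ∈ Icc a b, |f y| ≤ C) :
    Tendsto (fun n : ℕ => neuralOp m a b n f x) atTop (𝓝 (f x)) := by
  refine Metric.tendsto_nhds.2 fun ε hε => ?_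
  obtain ⟨d, hd, hfd⟩ := Metric.continuousWithinAt_iff.1 hcont (ε / 2) (half_pos hε)
  have hd2 : 0 < d / 2 := half_pos hd
  have hnd : Tendsto (fun n : ℕ => n * (d / 2)) atTop atTop :=
    tendsto_natCast_atTop_atTop.atTop_mul_const hd2
  have hfarWeight : Tendsto (fun n : ℕ => ε / 2 + (C + C) *
      (1 / (4 * m * (n * (d / 2) - 2) ^ (2 * m)) / activation m 1)) atTop (𝓝 (ε / 2)) := by
    have hden : Tendsto (fun n : ℕ => 4 * (m : ℝ) * (n * (d / 2) - 2) ^ (2 * m)) atTop atTop :=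
      ((tendsto_pow_atTop (by omega)).comp
        (tendsto_atTop_add_const_right _ (-2) hnd)).const_mul_atTop (by positivity)
    simpa using ((hden.const_div_atTop 1).div_const (activation m 1)).const_mul (C + C) |>.const_add
      (ε / 2)
  filter_upwards [hnd.eventually_gt_atTop 2, eventually_ceil_mul_le_floor_mul hab,
    hfarWeight.eventually_lt_const (half_lt_self hε)] with n hn hne hsmall
  refine (abs_neuralOp_sub_le hm hx hne hn (fun y hy hyx => ?_) fun y hy => ?_).trans_lt hsmall
  · exact (hfd hy (hyx.trans_lt (half_lt_self hd))).le
  · exact (abs_sub _ _).trans (add_le_add (hbdd y hy) (hbdd x hx))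

theorem abs_neuralOp_sub_le_fracTaylorBound {α a b x δ : ℝ} (hα0 : 0 < α) (hα1 : α < 1)
    (hδ : 0 < δ) (hx : x ∈ Icc a b) {N m n : ℕ} (hm : m ≠ 0) {f : ℝ → ℝ}
    (hfac : AbsolutelyContinuousOnInterval f a b)
    (hLac : ∀ k : ℕ, 1 ≤ k → k ≤ N → AbsolutelyContinuousOnInterval (iterCaputoLeft α x k f) x b)
    (hRac : ∀ k : ℕ, 1 ≤ k → k ≤ N → AbsolutelyContinuousOnInterval (iterCaputoRight α x k f) a x)
    (hLcont : ContinuousOn (iterCaputoLeft α x (N + 1) f) (Icc x b))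
    (hRcont : ContinuousOn (iterCaputoRight α x (N + 1) f) (Icc a x))
    (hn : 2 < (n : ℝ) ^ (1 - α)) (hab : ⌈(n : ℝ) * a⌉ ≤ ⌊(n : ℝ) * b⌋) :
    |neuralOp m a b n f x - f x| ≤ 1 / activation m 1 *
      (fracTaylorBound (caputoModulus α a b x (N + 1) f δ) ((N + 1) * α) δ (n ^ (-α)) +
        fracTaylorBound (caputoModulus α a b x (N + 1) f δ) ((N + 1) * α) δ (b - a) *
          (1 / (4 * m * ((n : ℝ) ^ (1 - α) - 2) ^ (2 * m)))) := by
  have hν : 0 < (N + 1) * α := by positivity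
  have hω := caputoModulus_nonneg α a b x (N + 1) f δ
  set E := fracTaylorBound (caputoModulus α a b x (N + 1) f δ) ((N + 1) * α) δ
  have hbound : ∀ d, ∀ y ∈ Icc a b, |y - x| ≤ d → |f y - f x| ≤ E d := fun d y hy hyx =>
    (abs_sub_le_of_caputoModulus hα0 hα1 hδ hx hfac hLac hRac hLcont hRcont hy).trans
      (fracTaylorBound_mono hω le_rfl hν hδ (abs_nonneg _) hyx)
  have hscale : (n : ℝ) * n ^ (-α) = n ^ (1 - α) := by
    have hn0 : (n : ℝ) ≠ 0 := fun h => by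
      rw [h, Real.zero_rpow (sub_pos.2 hα1).ne'] at hn
      exact hn.not_gt two_pos
    rw [mul_comm, ← Real.rpow_add_one hn0, neg_add_eq_sub]
  have hmain := abs_neuralOp_sub_le hm hx hab (hscale ▸ hn) (hbound _) fun y hy =>
    hbound (b - a) y hy (abs_sub_le_of_le_of_le hy.1 hy.2 hx.1 hx.2)
  have hE : 0 ≤ E (n ^ (-α)) := fracTaylorBound_nonneg hω hν hδ (by positivity)
  have hone : 1 ≤ 1 / activation m 1 :=
    one_le_one_div (activation_pos hm 1) (activation_one_le_one hm)
  rw [hscale] at hmain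
  calc |neuralOp m a b n f x - f x|
      ≤ 1 * E (n ^ (-α)) +
          E (b - a) * (1 / (4 * m * ((n : ℝ) ^ (1 - α) - 2) ^ (2 * m)) / activation m 1) := by
        rwa [one_mul]
    _ ≤ 1 / activation m 1 * E (n ^ (-α)) +
          E (b - a) * (1 / (4 * m * ((n : ℝ) ^ (1 - α) - 2) ^ (2 * m)) / activation m 1) := by
        gcongr
    _ = 1 / activation m 1 * (E (n ^ (-α)) +
          E (b - a) * (1 / (4 * m * ((n : ℝ) ^ (1 - α) - 2) ^ (2 * m)))) := by ring

theorem theorem37_general (α a b x : ℝ) (hα0 : 0 < α) (hα1 : α < 1) (hab : a < b)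
    (hx : x ∈ Set.Icc a b) (N m : ℕ) (hm : m ≠ 0) (f : ℝ → ℝ)
    (hfac : AbsolutelyContinuousOnInterval f a b)
    (hLac : ∀ k : ℕ, 1 ≤ k → k ≤ N → AbsolutelyContinuousOnInterval (iterCaputoLeft α x k f) x b)
    (hRac : ∀ k : ℕ, 1 ≤ k → k ≤ N → AbsolutelyContinuousOnInterval (iterCaputoRight α x k f) a x)
    (hLcont : ContinuousOn (iterCaputoLeft α x (N + 1) f) (Set.Icc x b))
    (hRcont : ContinuousOn (iterCaputoRight α x (N + 1) f) (Set.Icc a x)) :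
    (∀ n : ℕ, 2 < (n : ℝ) ^ (1 - α) → ⌈(n : ℝ) * a⌉ ≤ ⌊(n : ℝ) * b⌋ → ∀ δ : ℝ, 0 < δ →
      |neuralOp m a b n f x - f x| ≤
        2 * (1 + 4 ^ m : ℝ) ^ (1 / (2 * (m : ℝ))) * caputoModulus α a b x (N + 1) f δ /
            Real.Gamma (((N : ℝ) + 1) * α + 1) *
          ((1 / (n : ℝ) ^ (((N : ℝ) + 1) * α ^ 2) +
              (b - a) ^ (((N : ℝ) + 1) * α) /
                (4 * (m : ℝ) * ((n : ℝ) ^ (1 - α) - 2) ^ (2 * m))) +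
            1 / (δ * (((N : ℝ) + 1) * α + 1)) *
              (1 / (n : ℝ) ^ (α * (((N : ℝ) + 1) * α + 1)) +
                (b - a) ^ (((N : ℝ) + 1) * α + 1) /
                  (4 * (m : ℝ) * ((n : ℝ) ^ (1 - α) - 2) ^ (2 * m))))) ∧
    Filter.Tendsto (fun n : ℕ => neuralOp m a b n f x) Filter.atTop (nhds (f x)) := by
  have hfcont : ContinuousOn f (Icc a b) := uIcc_of_le hab.le ▸ hfac.continuousOn
  refine ⟨fun n hn hne δ hδ => ?_, ?_⟩
  · refine (abs_neuralOp_sub_le_fracTaylorBound hα0 hα1 hδ hx hm hfac hLac hRac hLcont hRcont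
      hn hne).trans_eq ?_
    have hpow : ∀ p : ℝ, ((n : ℝ) ^ (-α)) ^ p = 1 / (n : ℝ) ^ (α * p) := fun p => by
      rw [← Real.rpow_mul n.cast_nonneg, neg_mul, Real.rpow_neg n.cast_nonneg, one_div]
    rw [activation_one, one_div_one_div, fracTaylorBound, fracTaylorBound, hpow, hpow,
      show α * ((N + 1) * α) = (N + 1) * α ^ 2 by ring]
    ring
  · obtain ⟨C, hC⟩ := isCompact_Icc.exists_bound_of_continuousOn hfcont
    exact tendsto_neuralOp hm hab hx (hfcont x hx) hC

theorem theorem37 (α a b x : ℝ) (hα0 : 0 < α) (hα1 : α < 1) (hab : a < b)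
    (hx : x ∈ Set.Icc a b) (N m : ℕ) (hN : 1 ≤ N) (hm : 1 ≤ m) (f : ℝ → ℝ)
    (hf : ContinuousOn f (Set.Icc a b))
    -- `f' ∈ L_∞([a, b])`
    (hfac : AbsolutelyContinuousOnInterval f a b)
    (hf' : MeasureTheory.MemLp (deriv f) ⊤ (MeasureTheory.volume.restrict (Set.Icc a b)))
    -- the iterated derivatives are defined: each function that gets differentiated has an
    -- integrable derivative (as an absolutely continuous function)
    (hLac : ∀ k : ℕ, 1 ≤ k → k ≤ N → AbsolutelyContinuousOnInterval (iterCaputoLeft α x k f) x b)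
    (hRac : ∀ k : ℕ, 1 ≤ k → k ≤ N → AbsolutelyContinuousOnInterval (iterCaputoRight α x k f) a x)
    (hLcont : ∀ k : ℕ, k ≤ N + 1 → ContinuousOn (iterCaputoLeft α x k f) (Set.Icc x b))
    (hLzero : ∀ i : ℕ, 2 ≤ i → i ≤ N + 1 → iterCaputoLeft α x i f x = 0)
    (hRcont : ∀ k : ℕ, k ≤ N + 1 → ContinuousOn (iterCaputoRight α x k f) (Set.Icc a x))
    (hRzero : ∀ i : ℕ, 2 ≤ i → i ≤ N + 1 → iterCaputoRight α x i f x = 0) :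
    (∀ n : ℕ, 2 < (n : ℝ) ^ (1 - α) → ⌈(n : ℝ) * a⌉ ≤ ⌊(n : ℝ) * b⌋ → ∀ δ : ℝ, 0 < δ →
      |neuralOp m a b n f x - f x| ≤
        2 * (1 + 4 ^ m : ℝ) ^ (1 / (2 * (m : ℝ))) * caputoModulus α a b x (N + 1) f δ /
            Real.Gamma (((N : ℝ) + 1) * α + 1) *
          ((1 / (n : ℝ) ^ (((N : ℝ) + 1) * α ^ 2) +
              (b - a) ^ (((N : ℝ) + 1) * α) /
                (4 * (m : ℝ) * ((n : ℝ) ^ (1 - α) - 2) ^ (2 * m))) +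
            1 / (δ * (((N : ℝ) + 1) * α + 1)) *
              (1 / (n : ℝ) ^ (α * (((N : ℝ) + 1) * α + 1)) +
                (b - a) ^ (((N : ℝ) + 1) * α + 1) /
                  (4 * (m : ℝ) * ((n : ℝ) ^ (1 - α) - 2) ^ (2 * m))))) ∧
    Filter.Tendsto (fun n : ℕ => neuralOp m a b n f x) Filter.atTop (nhds (f x)) :=
  theorem37_general α a b x hα0 hα1 hab hx N m (Nat.one_le_iff_ne_zero.1 hm) f hfac hLac hRac
    (hLcont _ le_rfl) (hRcont _ le_rfl)
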